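/- Let $\mathcal H$ be a complex Hilbert space and let $\mathcal E$ be a quantum channel on $\mathcal H$, i.e. a trace-preserving completely positive linear map on the trace-class operators of $\mathcal H$, with channel elements (Kraus operators) $(E_k)_k$, i.e. bounded operators on $\mathcal H$ with $\mathcal E(\rho)=\sum_k E_k\rho E_k^\dagger$ for every trace-class $\rho$. Let $\mathcal E^*$ be the dual map on $\mathcal B(\mathcal H)$, determined by $\mathrm{Tr}(\rho\,\mathcal E^*(A))=\mathrm{Tr}(\mathcal E(\rho)A)$ for all states $\rho$, and let $$\mathcal A^N=\{A\in\mathcal B(\mathcal H): [A,E_k]=[A^\dagger,E_k]=0\ \text{for all }k\}$$ be the noiseless algebra, a von Neumann algebra. Let $X$ be a sharp observable on $\mathbb R$ represented by the self-adjoint operator $\widehat X$; that is, $X(\omega)$, for $\omega\subseteq\mathbb R$ Borel, are the spectral projectors of $\widehat X$. Call $X$ fixed by $\mathcal E$ if $X(\omega)=\mathcal E^*(X(\omega))$ for all Borel $\omega$. 1. If $\widehat X$ is bounded, then $X$ is fixed by $\mathcal E$ if and only if $\widehat X\in\mathcal A^N$, and if and only if $[\widehat X,E_k]=0$ for all $k$.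 2. If $\widehat X$ is any (possibly unbounded) self-adjoint operator, then $X$ is fixed by $\mathcal E$ if and only if $\widehat X$ is affiliated with $\mathcal A^N$ (i.e. $B\widehat X\subseteq\widehat X B$ for every $B$ in the commutant of $\mathcal A^N$), and if and only if $\widehat X$ commutes with every $E_k$ in the sense that $E_k\widehat X\subseteq\widehat X E_k$. -/

import Mathlib

open MeasureTheory
open scoped ComplexOrder InnerProductSpace

noncomputable section

namespace QInfo

/-! ### Trace-class operators, states -/

section TraceClass

variable (H : Type*) [NormedAddCommGroup H] [InnerProductSpace ℂ H] [CompleteSpace H]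

/-- The index set of a fixed Hilbert basis of `H`. -/
def BasisIndex : Set H := (exists_hilbertBasis ℂ H).choose

/-- A fixed Hilbert basis of `H` (the notions below do not depend on this choice). -/
def basis : HilbertBasis (BasisIndex H) ℂ H := (exists_hilbertBasis ℂ H).choose_spec.choose

variable {H}

/-- `B` is trace class: `∑ i, ⟨i| √(B† B) |i⟩` converges. -/
def IsTraceClass (B : H →L[ℂ] H) : Prop :=
  Summable fun i => ⟪basis H i, CFC.sqrt (star B * B) (basis H i)⟫_ℂ

/-- The trace `∑ i, ⟨i| B |i⟩` of a trace-class operator. -/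
def trace (B : H →L[ℂ] H) : ℂ := ∑' i, ⟪basis H i, B (basis H i)⟫_ℂ

variable (H) in
/-- The space `B_t(H)` of trace-class operators. The operators satisfying `IsTraceClass` form a
linear subspace of `B(H)`, so that the span adds nothing to them; it is written only in order to
have the subspace as a bundled object. -/
def traceClass : Submodule ℂ (H →L[ℂ] H) := Submodule.span ℂ {B | IsTraceClass B}

/-- States (density operators): positive trace-class operators of trace one. -/
def IsState (ρ : traceClass H) : Prop :=
  0 ≤ (ρ : H →L[ℂ] H) ∧ trace (ρ : H →L[ℂ] H) = 1

end TraceClass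

/-! ### Channels -/

section Channel

variable (H : Type*) [NormedAddCommGroup H] [InnerProductSpace ℂ H] [CompleteSpace H]

/-- A quantum channel on `H`: a trace-preserving completely positive linear map on the trace-class
operators. Complete positivity: for every `n`, if the block operator `(ρ i j)` on `Hⁿ` is positive,
then so is the block operator `(𝓔 (ρ i j))`. -/
structure QuantumChannel where
  /-- The action on trace-class operators. -/
  toLinearMap : traceClass H →ₗ[ℂ] traceClass H
  completelyPositive : ∀ (n : ℕ) (ρ : Fin n → Fin n → traceClass H),
    (∀ x : Fin n → H, 0 ≤ ∑ i, ∑ j, ⟪x i, (ρ i j : H →L[ℂ] H) (x j)⟫_ℂ) →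
    ∀ x : Fin n → H,
      0 ≤ ∑ i, ∑ j, ⟪x i, (toLinearMap (ρ i j) : H →L[ℂ] H) (x j)⟫_ℂ
  trace_map : ∀ ρ : traceClass H,
    trace (toLinearMap ρ : H →L[ℂ] H) = trace (ρ : H →L[ℂ] H)

variable {H}

/-- `B` is the image of `A` under the dual of the channel `𝓔`:
`Tr(ρ B) = Tr(𝓔(ρ) A)` for all states `ρ`. -/
def QuantumChannel.IsDualImage (𝓔 : QuantumChannel H) (A B : H →L[ℂ] H) : Prop :=
  ∀ ρ : traceClass H, IsState ρ →
    trace ((ρ : H →L[ℂ] H) * B) = trace ((𝓔.toLinearMap ρ : H →L[ℂ] H) * A)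

/-- The dual (Heisenberg picture) map `𝓔* : B(H) → B(H)`: `𝓔* A` is the unique bounded operator
with `Tr(ρ 𝓔*(A)) = Tr(𝓔(ρ) A)` for all states `ρ`. -/
def QuantumChannel.dual (𝓔 : QuantumChannel H) (A : H →L[ℂ] H) : H →L[ℂ] H :=
  Classical.epsilon (𝓔.IsDualImage A)

/-- The family `E` consists of channel elements (Kraus operators) of `𝓔`:
`𝓔(ρ) = ∑ k, E k ρ (E k)†`, the sum being taken in the weak operator topology. -/
def QuantumChannel.HasElements (𝓔 : QuantumChannel H) {ι : Type*} (E : ι → H →L[ℂ] H) : Prop :=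
  ∀ (ρ : traceClass H) (x y : H),
    HasSum (fun k => ⟪x, (E k * (ρ : H →L[ℂ] H) * star (E k)) y⟫_ℂ)
      ⟪x, (𝓔.toLinearMap ρ : H →L[ℂ] H) y⟫_ℂ

/-- The noiseless algebra of a channel with elements `E`, as a von Neumann algebra:
`{A | [A, E k] = [A†, E k] = 0 for all k}`. -/
def noiselessAlgebra {ι : Type*} (E : ι → H →L[ℂ] H) : VonNeumannAlgebra H where
  carrier := {A | ∀ k, A * E k = E k * A ∧ star A * E k = E k * star A}
  mul_mem' := by
    intro a b ha hb k
    have h1 : Commute a (E k) := (ha k).1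
    have h2 : Commute b (E k) := (hb k).1
    have h3 : Commute (star a) (E k) := (ha k).2
    have h4 : Commute (star b) (E k) := (hb k).2
    exact ⟨h1.mul_left h2, by rw [star_mul]; exact h4.mul_left h3⟩
  add_mem' := by
    intro a b ha hb k
    have h1 : Commute a (E k) := (ha k).1
    have h2 : Commute b (E k) := (hb k).1
    have h3 : Commute (star a) (E k) := (ha k).2
    have h4 : Commute (star b) (E k) := (hb k).2
    exact ⟨h1.add_left h2, by rw [star_add]; exact h3.add_left h4⟩
  algebraMap_mem' := by
    intro r k
    refine ⟨Algebra.commutes r (E k), ?_⟩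
    rw [← algebraMap_star_comm]
    exact Algebra.commutes _ (E k)
  star_mem' := by
    intro a ha k
    exact ⟨(ha k).2, by rw [star_star]; exact (ha k).1⟩
  centralizer_centralizer' := by
    have h : {A : H →L[ℂ] H | ∀ k, A * E k = E k * A ∧ star A * E k = E k * star A}
        = Set.centralizer (Set.range E ∪ Set.range fun k => star (E k)) := by
      ext A
      simp only [Set.mem_ofPred_eq, Set.mem_centralizer_iff, Set.mem_union, Set.mem_range]
      constructor
      · rintro hA m (⟨k, rfl⟩ | ⟨k, rfl⟩)
        · exact (hA k).1.symm
        · have := congrArg star (hA k).2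
          simpa [star_mul] using this
      · intro hA k
        refine ⟨(hA _ (Or.inl ⟨k, rfl⟩)).symm, ?_⟩
        have := congrArg star (hA _ (Or.inr ⟨k, rfl⟩))
        simpa [star_mul] using this
    change Set.centralizer (Set.centralizer
      {A : H →L[ℂ] H | ∀ k, A * E k = E k * A ∧ star A * E k = E k * star A}) =
      {A : H →L[ℂ] H | ∀ k, A * E k = E k * A ∧ star A * E k = E k * star A}
    rw [h, Set.centralizer_centralizer_centralizer]

end Channel

/-! ### Observables -/

section Observable

/-- An observable with outcomes in `Ω` (a positive operator valued measure): it assigns to each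
measurable `ω ⊆ Ω` a positive operator, is countably additive in the weak operator topology, and
`X(Ω) = 1`. Values at non-measurable sets carry no meaning and are never used. -/
structure Observable (Ω : Type*) [MeasurableSpace Ω]
    (H : Type*) [NormedAddCommGroup H] [InnerProductSpace ℂ H] [CompleteSpace H] where
  /-- The effect `X(ω)`. -/
  effect : Set Ω → H →L[ℂ] H
  nonneg : ∀ ω, MeasurableSet ω → 0 ≤ effect ω
  effect_univ : effect Set.univ = 1
  hasSum_iUnion : ∀ f : ℕ → Set Ω, (∀ n, MeasurableSet (f n)) →
    Pairwise (Function.onFun Disjoint f) →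
    ∀ x y : H, HasSum (fun n => ⟪x, effect (f n) y⟫_ℂ) ⟪x, effect (⋃ n, f n) y⟫_ℂ

namespace Observable

variable {Ω : Type*} [MeasurableSpace Ω]
  {H : Type*} [NormedAddCommGroup H] [InnerProductSpace ℂ H] [CompleteSpace H]

lemma re_inner_effect_nonneg (X : Observable Ω H) (x : H) {ω : Set Ω} (hω : MeasurableSet ω) :
    0 ≤ (⟪x, X.effect ω x⟫_ℂ).re :=
  ((ContinuousLinearMap.nonneg_iff_isPositive _).1 (X.nonneg ω hω)).re_inner_nonneg_right x

lemma effect_empty (X : Observable Ω H) (x y : H) : ⟪x, X.effect ∅ y⟫_ℂ = 0 := by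
  have h := X.hasSum_iUnion (fun _ => ∅) (fun _ => MeasurableSet.empty)
    (fun _ _ _ => disjoint_bot_left) x y
  exact tendsto_nhds_unique tendsto_const_nhds h.summable.tendsto_atTop_zero

/-- The distribution `ω ↦ ⟨x| X(ω) |x⟩` of the outcomes of `X` in the vector state `x`. -/
def law (X : Observable Ω H) (x : H) : Measure Ω :=
  Measure.ofMeasurable (fun ω _ => ENNReal.ofReal (⟪x, X.effect ω x⟫_ℂ).re)
    (by simp [X.effect_empty])
    (by
      intro f hf hd
      have h := Complex.hasSum_re (X.hasSum_iUnion f hf hd x x)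
      rw [← h.tsum_eq, ENNReal.ofReal_tsum_of_nonneg
        (fun n => X.re_inner_effect_nonneg x (hf n)) h.summable])

/-- `X` is sharp: all its effects are (orthogonal) projectors. -/
def IsSharp (X : Observable Ω H) : Prop :=
  ∀ ω, MeasurableSet ω → IsStarProjection (X.effect ω)

/-- The observable `X` is represented by the (possibly unbounded) self-adjoint operator `A`:
the effects `X(ω)` are the spectral projectors of `A`, i.e. `X` is the projection valued measure
with `A = ∫ t dX(t)`. Explicitly, the domain of `A` consists of those `x` for which
`∫ t² d⟨x, X(t) x⟩` is finite, and `⟨x, A x⟩ = ∫ t d⟨x, X(t) x⟩` for such `x`. -/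
structure IsRepresentedBy (X : Observable ℝ H) (A : H →ₗ.[ℂ] H) : Prop where
  isSelfAdjoint : IsSelfAdjoint A
  isSharp : X.IsSharp
  mem_domain_iff : ∀ x : H, x ∈ A.domain ↔ Integrable (fun t : ℝ => t ^ 2) (X.law x)
  inner_apply : ∀ x : A.domain, ⟪(x : H), A x⟫_ℂ = ((∫ t : ℝ, t ∂(X.law x) : ℝ) : ℂ)

/-- `X` is fixed by the channel `𝓔`: `X(ω) = 𝓔*(X(ω))` for all `ω`. -/
def IsFixedBy (X : Observable Ω H) (𝓔 : QuantumChannel H) : Prop :=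
  ∀ ω, MeasurableSet ω → X.effect ω = 𝓔.dual (X.effect ω)

end Observable

variable {H : Type*} [NormedAddCommGroup H] [InnerProductSpace ℂ H] [CompleteSpace H]

/-- The possibly unbounded operator `A` commutes with the bounded operator `B`: `B A ⊆ A B`,
i.e. `B` maps the domain of `A` to itself, and `A B x = B A x` for `x` in it. -/
def CommutesWith (A : H →ₗ.[ℂ] H) (B : H →L[ℂ] H) : Prop :=
  ∀ x : A.domain, ∃ h : B x ∈ A.domain, A ⟨B x, h⟩ = B (A x)

/-- The possibly unbounded operator `A` is affiliated with the von Neumann algebra `M`: it commutes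
with every operator of the commutant of `M`. -/
def IsAffiliatedWith (A : H →ₗ.[ℂ] H) (M : VonNeumannAlgebra H) : Prop :=
  ∀ B ∈ M.commutant, CommutesWith A B

end Observable

end QInfo

end

/-! The spectral projectors `X(ω)` are the meeting point of the three conditions.

Channel side. For a projection P one has 𝓔*(P) = ∑ E_k† P E_k. If P is fixed, then ∑ ‖P E_k x‖² = ‖P
x‖² for all x. This vanishes on ker P, so P E_k (1 - P) = 0. Trace preservation means ∑ E_k† E_k =
1, so 1 - P is fixed as well and (1 - P) E_k P = 0. Hence P commutes with every E_k; the converse is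
immediate (`eq_dual_iff`).

Operator side. A bounded T satisfies T A ⊆ A T if and only if it commutes with all spectral
projectors (`commutesWith_iff`). From projectors to A, one compares the scalar measures ⟨x, X(·) x⟩.
From A to projectors, a norm estimate shows that T cannot move spectral subspaces upwards
(`effect_Ici_mul_mul_effect_Icc`); T† commutes with A too, so T cannot move them downwards.

Affiliation lies in between: each E_k is in the commutant of the noiseless algebra, and the
projectors of a fixed X are in the algebra itself. -/

namespace QInfo

/-! ### Hilbert–Schmidt norms, valued in `ENNReal` so that sums can be exchanged freely. -/

section HilbertSchmidt

variable {H : Type*} [NormedAddCommGroup H] [InnerProductSpace ℂ H] [CompleteSpace H]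

/-- The squared Hilbert–Schmidt norm `∑ i, ‖T e_i‖²`. -/
noncomputable def hsNormSq (T : H →L[ℂ] H) : ENNReal := ∑' i, ‖T (basis H i)‖ₑ ^ 2

lemma tsum_enorm_inner_basis_sq (x : H) : ∑' i, ‖⟪basis H i, x⟫_ℂ‖ₑ ^ 2 = ‖x‖ₑ ^ 2 := by
  have h := Complex.hasSum_re ((basis H).hasSum_inner_mul_inner x x)
  have h2 : ∀ i, (⟪x, basis H i⟫_ℂ * ⟪basis H i, x⟫_ℂ).re = ‖⟪basis H i, x⟫_ℂ‖ ^ 2 := by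
    intro i
    rw [← inner_conj_symm, ← Complex.normSq_eq_conj_mul_self, Complex.ofReal_re,
      Complex.normSq_eq_norm_sq]
  simp only [h2] at h
  rw [inner_self_eq_norm_sq_to_K] at h
  have h3 : (((‖x‖ : ℝ) : ℂ) ^ 2).re = ‖x‖ ^ 2 := by norm_cast
  erw [h3] at h
  have h4 := ENNReal.ofReal_tsum_of_nonneg (fun i => by positivity) h.summable
  rw [h.tsum_eq] at h4
  simpa only [ENNReal.ofReal_pow (norm_nonneg _), ofReal_norm] using h4.symm

lemma hsNormSq_eq_tsum_tsum (T : H →L[ℂ] H) :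
    hsNormSq T = ∑' i, ∑' j, ‖⟪basis H j, T (basis H i)⟫_ℂ‖ₑ ^ 2 := by
  simp only [tsum_enorm_inner_basis_sq]; rfl

lemma inner_star_left (T : H →L[ℂ] H) (x y : H) : ⟪star T x, y⟫_ℂ = ⟪x, T y⟫_ℂ :=
  ContinuousLinearMap.adjoint_inner_left T y x

lemma inner_star_right (T : H →L[ℂ] H) (x y : H) : ⟪x, star T y⟫_ℂ = ⟪T x, y⟫_ℂ :=
  ContinuousLinearMap.adjoint_inner_right T x y

lemma hsNormSq_star (T : H →L[ℂ] H) : hsNormSq (star T) = hsNormSq T := by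
  rw [hsNormSq_eq_tsum_tsum, hsNormSq_eq_tsum_tsum, ENNReal.tsum_comm]
  refine tsum_congr fun i => tsum_congr fun j => ?_
  rw [inner_star_right, ← inner_conj_symm, RCLike.enorm_conj]

lemma hsNormSq_mul_le (B T : H →L[ℂ] H) : hsNormSq (B * T) ≤ ‖B‖ₑ ^ 2 * hsNormSq T := by
  unfold hsNormSq
  rw [← ENNReal.tsum_mul_left]
  refine ENNReal.tsum_le_tsum fun i => ?_
  rw [← mul_pow]
  gcongr
  exact B.le_opENorm _

lemma summable_norm_sq_of_tsum_ne_top {α : Type*} {f : α → ℂ} (h : ∑' a, ‖f a‖ₑ ^ 2 ≠ ⊤) :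
    Summable fun a => ‖f a‖ ^ 2 := by
  have h2 := ENNReal.summable_toReal h
  simpa [ENNReal.toReal_pow] using h2

lemma summable_inner_basis_sq {S : H →L[ℂ] H} (hS : hsNormSq S ≠ ⊤) :
    Summable fun p : BasisIndex H × BasisIndex H =>
      ‖⟪basis H p.2, S (basis H p.1)⟫_ℂ‖ ^ 2 := by
  apply summable_norm_sq_of_tsum_ne_top
  rwa [ENNReal.tsum_prod (f := fun i j => ‖⟪basis H j, S (basis H i)⟫_ℂ‖ₑ ^ 2),
    ← hsNormSq_eq_tsum_tsum]

/-- Cyclicity of the Hilbert–Schmidt inner product. -/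
lemma tsum_inner_eq_tsum_inner_star {S T : H →L[ℂ] H} (hS : hsNormSq S ≠ ⊤)
    (hT : hsNormSq T ≠ ⊤) :
    ∑' i, ⟪S (basis H i), T (basis H i)⟫_ℂ =
      ∑' i, ⟪star T (basis H i), star S (basis H i)⟫_ℂ := by
  -- Absolute summability of the double series, from |ab| ≤ a² + b², justifies exchanging the sums.
  have hsum : Summable (Function.uncurry fun i j : BasisIndex H =>
      ⟪S (basis H i), basis H j⟫_ℂ * ⟪basis H j, T (basis H i)⟫_ℂ) := by
    refine Summable.of_norm_bounded
      ((summable_inner_basis_sq hS).add (summable_inner_basis_sq hT)) ?_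
    rintro ⟨i, j⟩
    simp only [Function.uncurry_apply_pair, norm_mul]
    rw [← inner_conj_symm, RCLike.norm_conj]
    nlinarith [sq_nonneg (‖⟪basis H j, S (basis H i)⟫_ℂ‖ - ‖⟪basis H j, T (basis H i)⟫_ℂ‖),
      sq_nonneg ‖⟪basis H j, S (basis H i)⟫_ℂ‖, sq_nonneg ‖⟪basis H j, T (basis H i)⟫_ℂ‖]
  calc _ = ∑' i, ∑' j, ⟪S (basis H i), basis H j⟫_ℂ * ⟪basis H j, T (basis H i)⟫_ℂ := by
        simp only [(basis H).tsum_inner_mul_inner]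
    _ = ∑' j, ∑' i, ⟪S (basis H i), basis H j⟫_ℂ * ⟪basis H j, T (basis H i)⟫_ℂ :=
        hsum.tsum_comm.symm
    _ = _ := by
        refine tsum_congr fun j => ?_
        rw [← (basis H).tsum_inner_mul_inner]
        refine tsum_congr fun i => ?_
        rw [inner_star_left, inner_star_right, mul_comm]

end HilbertSchmidt

/-! ### States, their square roots and pure states. -/

section States

variable {H : Type*} [NormedAddCommGroup H] [InnerProductSpace ℂ H] [CompleteSpace H]

lemma star_sqrt (B : H →L[ℂ] H) : star (CFC.sqrt B) = CFC.sqrt B :=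
  (IsSelfAdjoint.of_nonneg (CFC.sqrt_nonneg B)).star_eq

lemma IsState.inner_apply {ρ : traceClass H} (hρ : IsState ρ) (x y : H) :
    ⟪x, (ρ : H →L[ℂ] H) y⟫_ℂ = ⟪CFC.sqrt (ρ : H →L[ℂ] H) x, CFC.sqrt (ρ : H →L[ℂ] H) y⟫_ℂ := by
  conv_lhs => rw [← CFC.sqrt_mul_sqrt_self (ρ : H →L[ℂ] H) hρ.1]
  rw [mul_apply_eq_comp, ← inner_star_left, star_sqrt]

/-- A divergent `tsum` is 0 by convention, so trace 1 already forces the diagonal sum to converge.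
Its terms are the ‖√ρ e_i‖². -/
lemma IsState.hsNormSq_sqrt_ne_top {ρ : traceClass H} (hρ : IsState ρ) :
    hsNormSq (CFC.sqrt (ρ : H →L[ℂ] H)) ≠ ⊤ := by
  have hs : Summable fun i => ⟪basis H i, (ρ : H →L[ℂ] H) (basis H i)⟫_ℂ := by
    by_contra h
    have := hρ.2
    rw [trace, tsum_eq_zero_of_not_summable h] at this
    exact zero_ne_one this
  have h2 := (Complex.hasSum_re hs.hasSum).summable
  have h3 : ∀ i, (⟪basis H i, (ρ : H →L[ℂ] H) (basis H i)⟫_ℂ).re =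
      ‖CFC.sqrt (ρ : H →L[ℂ] H) (basis H i)‖ ^ 2 := by
    intro i
    rw [hρ.inner_apply, inner_self_eq_norm_sq_to_K]
    norm_cast
  simp only [h3] at h2
  have h4 := h2.tsum_ofReal_ne_top
  unfold hsNormSq
  simpa only [ENNReal.ofReal_pow (norm_nonneg _), ofReal_norm] using h4

/-- Cyclicity applied to √ρ and √ρ B moves one square root past B, which turns the trace into a sum
of values of the quadratic form of B. -/
lemma IsState.trace_mul {ρ : traceClass H} (hρ : IsState ρ) (B : H →L[ℂ] H) :
    trace ((ρ : H →L[ℂ] H) * B) = ∑' i, ⟪CFC.sqrt (ρ : H →L[ℂ] H) (basis H i),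
      B (CFC.sqrt (ρ : H →L[ℂ] H) (basis H i))⟫_ℂ := by
  set R := CFC.sqrt (ρ : H →L[ℂ] H)
  have hR := hρ.hsNormSq_sqrt_ne_top
  have hRB : hsNormSq (R * B) ≠ ⊤ := by
    rw [← hsNormSq_star, star_mul, star_sqrt]
    exact ((hsNormSq_mul_le _ _).trans_lt (ENNReal.mul_lt_top (by finiteness) hR.lt_top)).ne
  calc _ = ∑' i, ⟪R (basis H i), (R * B) (basis H i)⟫_ℂ := by
        refine tsum_congr fun i => ?_
        rw [mul_apply_eq_comp, hρ.inner_apply]; rfl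
    _ = _ := by
        rw [tsum_inner_eq_tsum_inner_star hR hRB]
        refine tsum_congr fun i => ?_
        rw [star_mul, star_sqrt, mul_apply_eq_comp, inner_star_left]

lemma tsum_coe_norm_sq {α F : Type*} [NormedAddCommGroup F] (f : α → F) :
    ∑' a, (((‖f a‖ ^ 2 : ℝ)) : ℂ) = ((∑' a, ‖f a‖ₑ ^ 2).toReal : ℂ) := by
  rw [← Complex.ofReal_tsum, ENNReal.tsum_toReal_eq (fun a => by finiteness)]
  simp [ENNReal.toReal_pow]

lemma inner_projection_self {P : H →L[ℂ] H} (hP : IsStarProjection P) (x : H) :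
    ⟪x, P x⟫_ℂ = ((‖P x‖ ^ 2 : ℝ) : ℂ) := by
  have h : P x = star P (P x) := by
    rw [hP.isSelfAdjoint.star_eq, ← mul_apply_eq_comp, hP.isIdempotentElem.eq]
  rw [h, inner_star_right, inner_self_eq_norm_sq_to_K, ← h]
  norm_cast

/-- The trace of `ρ P` for a projection `P`, as a Hilbert–Schmidt norm. -/
lemma IsState.trace_mul_projection {ρ : traceClass H} (hρ : IsState ρ) {P : H →L[ℂ] H}
    (hP : IsStarProjection P) :
    trace ((ρ : H →L[ℂ] H) * P) = ((hsNormSq (P * CFC.sqrt (ρ : H →L[ℂ] H))).toReal : ℂ) := by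
  rw [hρ.trace_mul, hsNormSq, ← tsum_coe_norm_sq]
  exact tsum_congr fun i => inner_projection_self hP _

/-- The pure state of a unit vector. -/
lemma exists_isState_rankOne {x : H} (hx : ‖x‖ = 1) :
    ∃ ρ : traceClass H, IsState ρ ∧ (ρ : H →L[ℂ] H) = InnerProductSpace.rankOne ℂ x x ∧
      CFC.sqrt (ρ : H →L[ℂ] H) = InnerProductSpace.rankOne ℂ x x := by
  set B : H →L[ℂ] H := InnerProductSpace.rankOne ℂ x x
  have hB : IsStarProjection B := InnerProductSpace.isStarProjection_rankOne_self hx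
  have hB0 : 0 ≤ B := hB.nonneg
  have hsq : CFC.sqrt B = B := CFC.sqrt_unique hB.isIdempotentElem.eq hB0
  have hin : ∀ i, ⟪basis H i, B (basis H i)⟫_ℂ = ⟪x, basis H i⟫_ℂ * ⟪basis H i, x⟫_ℂ := by
    intro i; simp [B]
  have htc : IsTraceClass B := by
    unfold IsTraceClass
    rw [hB.isSelfAdjoint.star_eq, hB.isIdempotentElem.eq, hsq]
    simp only [hin]
    exact (basis H).summable_inner_mul_inner x x
  refine ⟨⟨B, Submodule.subset_span htc⟩, ⟨hB0, ?_⟩, rfl, hsq⟩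
  simp only [trace, hin, (basis H).tsum_inner_mul_inner]
  rw [inner_self_eq_norm_sq_to_K, hx]; simp

lemma trace_rankOne_mul (x : H) (B : H →L[ℂ] H) :
    trace ((InnerProductSpace.rankOne ℂ x x : H →L[ℂ] H) * B) = ⟪x, B x⟫_ℂ := by
  rw [trace, ← inner_star_left, ← (basis H).tsum_inner_mul_inner]
  refine tsum_congr fun i => ?_
  rw [inner_star_left]
  simp

lemma hsNormSq_mul_rankOne {x : H} (hx : ‖x‖ = 1) (T : H →L[ℂ] H) :
    hsNormSq (T * InnerProductSpace.rankOne ℂ x x) = ‖T x‖ₑ ^ 2 := by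
  unfold hsNormSq
  have h : ∀ i, ‖(T * InnerProductSpace.rankOne ℂ x x) (basis H i)‖ₑ ^ 2 =
      ‖⟪basis H i, x⟫_ℂ‖ₑ ^ 2 * ‖T x‖ₑ ^ 2 := by
    intro i
    rw [mul_apply_eq_comp, InnerProductSpace.rankOne_apply, map_smul, enorm_smul,
      mul_pow, ← inner_conj_symm, RCLike.enorm_conj]
  have hx1 : ‖x‖ₑ = 1 := by rw [← ofReal_norm, hx, ENNReal.ofReal_one]
  simp only [h]
  rw [ENNReal.tsum_mul_right, tsum_enorm_inner_basis_sq, hx1, one_pow, one_mul]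

omit [CompleteSpace H] in
lemma eq_of_inner_self_eq_of_norm_eq_one {B C : H →L[ℂ] H}
    (h : ∀ x : H, ‖x‖ = 1 → ⟪x, B x⟫_ℂ = ⟪x, C x⟫_ℂ) : B = C := by
  apply ContinuousLinearMap.coe_inj.1
  rw [← ext_inner_map]
  intro x
  rcases eq_or_ne x 0 with rfl | hx
  · simp
  have hn : (‖x‖ : ℂ) ≠ 0 := by exact_mod_cast norm_ne_zero_iff.2 hx
  have h1 := h ((‖x‖ : ℂ)⁻¹ • x) (by rw [norm_smul]; simp [hx])
  simp only [map_smul, inner_smul_left, inner_smul_right] at h1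
  have h2 : ⟪x, B x⟫_ℂ = ⟪x, C x⟫_ℂ := by simpa [hn] using h1
  calc ⟪B x, x⟫_ℂ = _ := (inner_conj_symm _ _).symm
    _ = _ := by rw [h2]
    _ = ⟪C x, x⟫_ℂ := inner_conj_symm _ _

end States

/-! ### The dual map on projections, and its fixed projections. -/

section Kraus

variable {H : Type*} [NormedAddCommGroup H] [InnerProductSpace ℂ H] [CompleteSpace H]
  {𝓔 : QuantumChannel H} {ι : Type*} {E : ι → H →L[ℂ] H}

lemma QuantumChannel.isDualImage_unique {A B C : H →L[ℂ] H} (hB : 𝓔.IsDualImage A B)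
    (hC : 𝓔.IsDualImage A C) : B = C := by
  refine eq_of_inner_self_eq_of_norm_eq_one fun x hx => ?_
  obtain ⟨ρ, hρ, hρ1, -⟩ := exists_isState_rankOne hx
  rw [← trace_rankOne_mul, ← trace_rankOne_mul, ← hρ1, hB ρ hρ, hC ρ hρ]

lemma QuantumChannel.isState_map {ρ : traceClass H} (hρ : IsState ρ) :
    IsState (𝓔.toLinearMap ρ) := by
  have h0 := (ContinuousLinearMap.nonneg_iff_isPositive _).1 hρ.1
  refine ⟨?_, by rw [𝓔.trace_map, hρ.2]⟩
  have h := 𝓔.completelyPositive 1 (fun _ _ => ρ) (fun x => by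
    simpa using h0.inner_nonneg_right (x 0))
  rw [ContinuousLinearMap.nonneg_iff_isPositive, ContinuousLinearMap.isPositive_iff_complex]
  intro x
  have h1 : (0 : ℂ) ≤ ⟪x, (𝓔.toLinearMap ρ : H →L[ℂ] H) x⟫_ℂ := by simpa using h (fun _ => x)
  have h2 : ⟪(𝓔.toLinearMap ρ : H →L[ℂ] H) x, x⟫_ℂ = ⟪x, (𝓔.toLinearMap ρ : H →L[ℂ] H) x⟫_ℂ := by
    rw [← inner_conj_symm]
    exact Complex.conj_eq_iff_im.2 (Complex.nonneg_iff.1 h1).2.symm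
  rw [h2]
  exact ⟨Complex.ext rfl (Complex.nonneg_iff.1 h1).2, (Complex.nonneg_iff.1 h1).1⟩

/-- The weakly convergent Kraus sum enters only through diagonal matrix elements at the vectors P
e_i. There all terms are nonnegative, so summing over i and over k commutes. -/
lemma QuantumChannel.HasElements.trace_map_mul_projection (hE : 𝓔.HasElements E)
    {ρ : traceClass H} (hρ : IsState ρ) {P : H →L[ℂ] H} (hP : IsStarProjection P) :
    trace ((𝓔.toLinearMap ρ : H →L[ℂ] H) * P) =
      ((∑' k, hsNormSq (P * E k * CFC.sqrt (ρ : H →L[ℂ] H))).toReal : ℂ) := by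
  have hσ : IsState (𝓔.toLinearMap ρ) := 𝓔.isState_map hρ
  rw [hσ.trace_mul_projection hP]
  congr 2
  -- Passing to adjoints produces ‖√σ P e_i‖² = ⟨P e_i, σ P e_i⟩ for σ = 𝓔(ρ), to which the Kraus
  -- formula applies.
  rw [← hsNormSq_star, star_mul, star_sqrt, hP.isSelfAdjoint.star_eq]
  have h1 : ∀ k, hsNormSq (P * E k * CFC.sqrt (ρ : H →L[ℂ] H)) =
      ∑' i, ‖CFC.sqrt (ρ : H →L[ℂ] H) (star (E k) (P (basis H i)))‖ₑ ^ 2 := by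
    intro k
    rw [← hsNormSq_star, star_mul, star_mul, star_sqrt, hP.isSelfAdjoint.star_eq]; rfl
  simp only [h1]
  rw [ENNReal.tsum_comm]
  refine tsum_congr fun i => ?_
  have h2 := Complex.hasSum_re (hE ρ (P (basis H i)) (P (basis H i)))
  have h3 : ∀ k, (⟪P (basis H i), (E k * (ρ : H →L[ℂ] H) * star (E k)) (P (basis H i))⟫_ℂ).re =
      ‖CFC.sqrt (ρ : H →L[ℂ] H) (star (E k) (P (basis H i)))‖ ^ 2 := by
    intro k
    rw [mul_apply_eq_comp, mul_apply_eq_comp, ← inner_star_left,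
      hρ.inner_apply, inner_self_eq_norm_sq_to_K]
    norm_cast
  simp only [h3] at h2
  rw [hσ.inner_apply, inner_self_eq_norm_sq_to_K] at h2
  have h4 := ENNReal.ofReal_tsum_of_nonneg (fun k => by positivity) h2.summable
  simp only [ENNReal.ofReal_pow (norm_nonneg _), ofReal_norm] at h4
  rw [← h4, h2.tsum_eq, mul_apply_eq_comp]
  rw [← ofReal_norm, ← ENNReal.ofReal_pow (norm_nonneg _)]
  norm_cast

/-- Trace preservation: `∑ k, (E k)† E k = 1`. -/
lemma QuantumChannel.HasElements.tsum_enorm_sq (hE : 𝓔.HasElements E) (x : H) :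
    ∑' k, ‖E k x‖ₑ ^ 2 = ‖x‖ₑ ^ 2 := by
  have key : ∀ x : H, ‖x‖ = 1 → ∑' k, ‖E k x‖ₑ ^ 2 = 1 := by
    intro x hx
    obtain ⟨ρ, hρ, -, hρ2⟩ := exists_isState_rankOne hx
    have h := hE.trace_map_mul_projection hρ (P := 1) (.one _)
    simp only [mul_one, one_mul, hρ2, hsNormSq_mul_rankOne hx] at h
    rw [𝓔.trace_map, hρ.2] at h
    -- Since `toReal` sends ⊤ to 0, the value 1 also rules out divergence.
    exact (ENNReal.toReal_eq_one_iff _).1 (by exact_mod_cast h.symm)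
  rcases eq_or_ne x 0 with rfl | hx
  · simp
  have hn : (‖x‖ : ℂ) ≠ 0 := by exact_mod_cast norm_ne_zero_iff.2 hx
  have h := key ((‖x‖ : ℂ)⁻¹ • x) (by rw [norm_smul]; simp [hx])
  have hx2 : x = (‖x‖ : ℂ) • ((‖x‖ : ℂ)⁻¹ • x) := by rw [smul_smul, mul_inv_cancel₀ hn, one_smul]
  set u := (‖x‖ : ℂ)⁻¹ • x
  have h5 : ∀ k, ‖E k x‖ₑ ^ 2 = ‖x‖ₑ ^ 2 * ‖E k u‖ₑ ^ 2 := by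
    intro k
    conv_lhs => rw [hx2, map_smul, enorm_smul, mul_pow]
    congr 2
    rw [← ofReal_norm, ← ofReal_norm]; simp
  simp only [h5]
  rw [ENNReal.tsum_mul_left, h, mul_one]

omit [CompleteSpace H] in
/-- A family of operators with `∑ k, ‖F k x‖² ≤ ‖x‖²` as an operator into `ℓ²`. -/
lemma exists_lp_map {F : ι → H →L[ℂ] H} (hF : ∀ x, ∑' k, ‖F k x‖ₑ ^ 2 ≤ ‖x‖ₑ ^ 2) :
    ∃ V : H →L[ℂ] lp (fun _ : ι => H) 2, ∀ x k, V x k = F k x := by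
  have hne : ∀ x, ∑' k, ‖F k x‖ₑ ^ 2 ≠ ⊤ := fun x => ((hF x).trans_lt (by finiteness)).ne
  have hs : ∀ x, Summable fun k => ‖F k x‖ ^ 2 := fun x => by
    simpa [ENNReal.toReal_pow] using ENNReal.summable_toReal (hne x)
  have hm : ∀ x, Memℓp (fun k => F k x) 2 := fun x => by
    refine memℓp_gen ?_
    simpa using hs x
  let V₀ : H →ₗ[ℂ] lp (fun _ : ι => H) 2 :=
    { toFun := fun x => ⟨fun k => F k x, hm x⟩
      map_add' := fun x y => by ext k; exact map_add (F k) x y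
      map_smul' := fun c x => by ext k; exact map_smul (F k) c x }
  refine ⟨V₀.mkContinuous 1 fun x => ?_, fun x k => rfl⟩
  have h1 : ‖V₀ x‖ ^ 2 = ∑' k, ‖F k x‖ ^ 2 := by
    have := lp.norm_rpow_eq_tsum (p := 2) (by norm_num) (V₀ x)
    have hV : ∀ k, (V₀ x : ι → H) k = F k x := fun _ => rfl
    simpa [hV] using this
  have h2 : ∑' k, ‖F k x‖ ^ 2 ≤ ‖x‖ ^ 2 := by
    have := ENNReal.toReal_mono (by finiteness) (hF x)
    rw [ENNReal.tsum_toReal_eq (fun a => by finiteness)] at this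
    simpa [ENNReal.toReal_pow] using this
  rw [one_mul]
  exact (sq_le_sq₀ (norm_nonneg _) (norm_nonneg _)).1 (h1.trans_le h2)

/-- The dual of a channel with elements `E k` on projections: `𝓔*(P) = ∑ k, (E k)† P (E k)`. -/
lemma QuantumChannel.HasElements.exists_isDualImage (hE : 𝓔.HasElements E) {P : H →L[ℂ] H}
    (hP : IsStarProjection P) :
    ∃ B : H →L[ℂ] H, 𝓔.IsDualImage P B ∧
      ∀ x, ⟪x, B x⟫_ℂ = ((∑' k, ‖P (E k x)‖ₑ ^ 2).toReal : ℂ) := by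
  have hle : ∀ x, ∑' k, ‖(P * E k) x‖ₑ ^ 2 ≤ ‖x‖ₑ ^ 2 := by
    intro x
    rw [← hE.tsum_enorm_sq x]
    refine ENNReal.tsum_le_tsum fun k => ?_
    gcongr
    rw [← ofReal_norm, ← ofReal_norm]
    refine ENNReal.ofReal_le_ofReal ?_
    calc ‖(P * E k) x‖ ≤ ‖P‖ * ‖E k x‖ := P.le_opNorm _
      _ ≤ 1 * ‖E k x‖ := by gcongr; exact hP.norm_le
      _ = _ := one_mul _
  -- V stacks the operators P E_k into one map to ℓ²(ι, H); the dual image is V† V.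
  obtain ⟨V, hV⟩ := exists_lp_map hle
  have hin : ∀ x, ⟪x, (V.adjoint ∘L V) x⟫_ℂ = ((∑' k, ‖P (E k x)‖ₑ ^ 2).toReal : ℂ) := by
    intro x
    rw [ContinuousLinearMap.comp_apply, ContinuousLinearMap.adjoint_inner_right,
      lp.inner_eq_tsum, ← tsum_coe_norm_sq]
    refine tsum_congr fun k => ?_
    rw [hV, inner_self_eq_norm_sq_to_K]
    norm_cast
  refine ⟨V.adjoint ∘L V, fun ρ hρ => ?_, hin⟩
  rw [hρ.trace_mul, hE.trace_map_mul_projection hρ hP]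
  simp only [hin, hsNormSq]
  rw [← Complex.ofReal_tsum, ENNReal.tsum_comm, ENNReal.tsum_toReal_eq]
  · rfl
  · exact fun i => ((hle _).trans_lt (by finiteness)).ne

/-- A fixed P makes both off-diagonal blocks of each E_k vanish: a sum of squares that is zero has
only zero terms. -/
lemma QuantumChannel.HasElements.eq_dual_iff (hE : 𝓔.HasElements E) {P : H →L[ℂ] H}
    (hP : IsStarProjection P) : P = 𝓔.dual P ↔ ∀ k, Commute P (E k) := by
  obtain ⟨B, hB, hBin⟩ := hE.exists_isDualImage hP
  have hdual : 𝓔.dual P = B := 𝓔.isDualImage_unique (Classical.epsilon_spec ⟨B, hB⟩) hB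
  have hne : ∀ (Q : H →L[ℂ] H) x, IsStarProjection Q → ∑' k, ‖Q (E k x)‖ₑ ^ 2 ≤ ‖x‖ₑ ^ 2 := by
    intro Q x hQ
    rw [← hE.tsum_enorm_sq x]
    refine ENNReal.tsum_le_tsum fun k => ?_
    gcongr
    rw [← ofReal_norm, ← ofReal_norm]
    refine ENNReal.ofReal_le_ofReal ((Q.le_opNorm _).trans ?_)
    exact mul_le_of_le_one_left (norm_nonneg _) hQ.norm_le
  rw [hdual]
  constructor
  · intro h
    have h1 : ∀ x, ∑' k, ‖P (E k x)‖ₑ ^ 2 = ‖P x‖ₑ ^ 2 := by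
      intro x
      have h2 := hBin x
      rw [← h, inner_projection_self hP, Complex.ofReal_inj] at h2
      rw [← ENNReal.toReal_eq_toReal_iff' ((hne P x hP).trans_lt (by finiteness)).ne (by finiteness),
        ← h2]
      simp [ENNReal.toReal_pow]
    have pyth : ∀ y : H, ‖y‖ₑ ^ 2 = ‖P y‖ₑ ^ 2 + ‖(1 - P) y‖ₑ ^ 2 := by
      intro y
      have ho : ⟪P y, (1 - P) y⟫_ℂ = 0 := by
        rw [← inner_star_right, hP.isSelfAdjoint.star_eq, ← mul_apply_eq_comp,
          mul_sub, mul_one, hP.isIdempotentElem.eq, sub_self]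
        simp
      have h3 := norm_add_sq_eq_norm_sq_add_norm_sq_of_inner_eq_zero _ _ ho
      have h4 : P y + (1 - P) y = y := by simp
      rw [h4] at h3
      simp only [← ofReal_norm, ← ENNReal.ofReal_pow (norm_nonneg _)]
      rw [← ENNReal.ofReal_add (by positivity) (by positivity)]
      congr 1
      linarith [h3]
    -- Subtracting `h1` from trace preservation, via Pythagoras, shows that 1 - P is fixed too; the
    -- cancellation needs ‖P x‖² finite.
    have h2 : ∀ x, ∑' k, ‖(1 - P) (E k x)‖ₑ ^ 2 = ‖(1 - P) x‖ₑ ^ 2 := by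
      intro x
      have h3 := hE.tsum_enorm_sq x
      simp only [fun k => pyth (E k x)] at h3
      rw [ENNReal.tsum_add, h1, pyth x] at h3
      exact (ENNReal.add_right_inj (by finiteness)).1 h3
    have z1 : ∀ k, P * E k * (1 - P) = 0 := by
      intro k
      ext x
      have h3 := h1 ((1 - P) x)
      rw [← mul_apply_eq_comp P, mul_sub, mul_one, hP.isIdempotentElem.eq, sub_self,
        zero_apply, enorm_zero, zero_pow two_ne_zero, ENNReal.tsum_eq_zero] at h3
      simpa using h3 k
    have z2 : ∀ k, (1 - P) * E k * P = 0 := by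
      intro k
      ext x
      have h3 := h2 (P x)
      rw [← mul_apply_eq_comp (1 - P), sub_mul, one_mul, hP.isIdempotentElem.eq,
        sub_self, zero_apply, enorm_zero, zero_pow two_ne_zero,
        ENNReal.tsum_eq_zero] at h3
      simpa using h3 k
    intro k
    have e1 := z1 k
    have e2 := z2 k
    rw [mul_sub, mul_one, sub_eq_zero] at e1
    rw [sub_mul, sub_mul, one_mul, sub_eq_zero] at e2
    exact e1.trans e2.symm
  · intro h
    refine eq_of_inner_self_eq_of_norm_eq_one fun x _ => ?_
    have h1 : ∀ k, P (E k x) = E k (P x) := fun k => DFunLike.congr_fun (h k) x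
    rw [hBin x, inner_projection_self hP]
    simp only [h1, hE.tsum_enorm_sq]
    simp [ENNReal.toReal_pow]

/-- A sharp observable is fixed if and only if its effects commute with all channel elements. -/
lemma QuantumChannel.HasElements.isFixedBy_iff (hE : 𝓔.HasElements E) {Ω : Type*}
    [MeasurableSpace Ω] {X : Observable Ω H} (hX : X.IsSharp) :
    X.IsFixedBy 𝓔 ↔ ∀ k, ∀ ω, MeasurableSet ω → Commute (X.effect ω) (E k) :=
  ⟨fun h k ω hω => (hE.eq_dual_iff (hX ω hω)).1 (h ω hω) k,
    fun h ω hω => (hE.eq_dual_iff (hX ω hω)).2 fun k => h k ω hω⟩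

end Kraus

/-! ### Calculus of sharp observables and of their scalar laws. -/

namespace Observable

variable {Ω : Type*} [MeasurableSpace Ω]
  {H : Type*} [NormedAddCommGroup H] [InnerProductSpace ℂ H] [CompleteSpace H]
  {X : Observable Ω H}

lemma law_apply (X : Observable Ω H) (x : H) {ω : Set Ω} (hω : MeasurableSet ω) :
    X.law x ω = ENNReal.ofReal (⟪x, X.effect ω x⟫_ℂ).re :=
  Measure.ofMeasurable_apply ω hω

instance (X : Observable Ω H) (x : H) : IsFiniteMeasure (X.law x) :=
  ⟨by rw [law_apply X x MeasurableSet.univ]; exact ENNReal.ofReal_lt_top⟩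

lemma law_real_univ (X : Observable Ω H) (x : H) : (X.law x).real Set.univ = ‖x‖ ^ 2 := by
  rw [Measure.real, law_apply X x MeasurableSet.univ, X.effect_univ,
    ENNReal.toReal_ofReal (by simpa using inner_self_nonneg (𝕜 := ℂ) (x := x))]
  exact inner_self_eq_norm_sq (𝕜 := ℂ) x

lemma effect_union (X : Observable Ω H) {a b : Set Ω} (ha : MeasurableSet a)
    (hb : MeasurableSet b) (hab : Disjoint a b) :
    X.effect (a ∪ b) = X.effect a + X.effect b := by
  refine eq_of_inner_self_eq_of_norm_eq_one fun x _ => ?_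
  have h := measure_union (μ := X.law x) hab hb
  rw [law_apply X x (ha.union hb), law_apply X x ha, law_apply X x hb,
    ← ENNReal.ofReal_add (X.re_inner_effect_nonneg x ha) (X.re_inner_effect_nonneg x hb),
    ENNReal.ofReal_eq_ofReal_iff (X.re_inner_effect_nonneg x (ha.union hb))
      (add_nonneg (X.re_inner_effect_nonneg x ha) (X.re_inner_effect_nonneg x hb))] at h
  have him : ∀ ω, MeasurableSet ω → (⟪x, X.effect ω x⟫_ℂ).im = 0 := fun ω hω =>
    (Complex.nonneg_iff.1
      (((ContinuousLinearMap.nonneg_iff_isPositive _).1 (X.nonneg ω hω)).inner_nonneg_right x)).2.symm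
  rw [add_apply, inner_add_right]
  apply Complex.ext
  · rw [Complex.add_re, h]
  · rw [Complex.add_im, him _ (ha.union hb), him _ ha, him _ hb, add_zero]

lemma effect_empty' (X : Observable Ω H) : X.effect ∅ = 0 :=
  eq_of_inner_self_eq_of_norm_eq_one fun x _ => by simp [X.effect_empty]

lemma effect_compl (X : Observable Ω H) {a : Set Ω} (ha : MeasurableSet a) :
    X.effect aᶜ = 1 - X.effect a := by
  rw [eq_sub_iff_add_eq, add_comm, ← X.effect_union ha ha.compl disjoint_compl_right,
    Set.union_compl_self, X.effect_univ]

/-- If P, Q and P + Q are idempotent, then PQ + QP = 0, and anticommuting with an idempotent forces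
PQ = 0. -/
lemma IsSharp.effect_mul_of_disjoint (hX : X.IsSharp) {a b : Set Ω} (ha : MeasurableSet a)
    (hb : MeasurableSet b) (hab : Disjoint a b) : X.effect a * X.effect b = 0 := by
  have h := (hX _ (ha.union hb)).isIdempotentElem.eq
  have h1 := (hX _ ha).isIdempotentElem.eq
  have h2 := (hX _ hb).isIdempotentElem.eq
  rw [X.effect_union ha hb hab, add_mul, mul_add, mul_add, h1, h2] at h
  have : IsAddTorsionFree (H →L[ℂ] H) := .of_isTorsionFree ℂ _
  refine (hX _ ha).isIdempotentElem.mul_eq_zero_of_anticommute ?_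
  have h3 : X.effect a + X.effect b + (X.effect a * X.effect b + X.effect b * X.effect a) =
      X.effect a + X.effect b := by
    conv_rhs => rw [← h]
    abel
  exact add_eq_left.1 h3

lemma IsSharp.effect_mul (hX : X.IsSharp) {a b : Set Ω} (ha : MeasurableSet a)
    (hb : MeasurableSet b) : X.effect a * X.effect b = X.effect (a ∩ b) := by
  have h1 : X.effect a = X.effect (a ∩ b) + X.effect (a \ b) := by
    rw [← X.effect_union (ha.inter hb) (ha.diff hb) Set.disjoint_sdiff_inter.symm,
      Set.inter_union_sdiff]
  have h2 : X.effect b = X.effect (a ∩ b) + X.effect (b \ a) := by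
    rw [← X.effect_union (ha.inter hb) (hb.diff ha)
      (Set.disjoint_sdiff_right.mono_left Set.inter_subset_left), Set.inter_comm,
      Set.inter_union_sdiff]
  rw [h1, h2, add_mul, mul_add, mul_add, (hX _ (ha.inter hb)).isIdempotentElem.eq,
    hX.effect_mul_of_disjoint (ha.inter hb) (hb.diff ha)
      (Set.disjoint_sdiff_right.mono_left Set.inter_subset_left),
    hX.effect_mul_of_disjoint (ha.diff hb) (ha.inter hb) Set.disjoint_sdiff_inter,
    hX.effect_mul_of_disjoint (ha.diff hb) (hb.diff ha)
      (Set.disjoint_sdiff_right.mono_left Set.sdiff_subset)]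
  simp

lemma IsSharp.commute_effect (hX : X.IsSharp) {a b : Set Ω} (ha : MeasurableSet a)
    (hb : MeasurableSet b) : Commute (X.effect a) (X.effect b) := by
  rw [Commute, SemiconjBy, hX.effect_mul ha hb, hX.effect_mul hb ha, Set.inter_comm]

lemma IsSharp.law_apply (hX : X.IsSharp) (x : H) {ω : Set Ω} (hω : MeasurableSet ω) :
    X.law x ω = ‖X.effect ω x‖ₑ ^ 2 := by
  rw [X.law_apply x hω, inner_projection_self (hX ω hω), Complex.ofReal_re,
    ENNReal.ofReal_pow (norm_nonneg _), ofReal_norm]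

lemma IsSharp.law_eq_zero_iff (hX : X.IsSharp) (x : H) {ω : Set Ω} (hω : MeasurableSet ω) :
    X.law x ω = 0 ↔ X.effect ω x = 0 := by
  rw [hX.law_apply x hω]; simp

lemma IsSharp.law_effect (hX : X.IsSharp) (x : H) {a : Set Ω} (ha : MeasurableSet a) :
    X.law (X.effect a x) = (X.law x).restrict a := by
  ext ω hω
  rw [Measure.restrict_apply hω, hX.law_apply _ hω, hX.law_apply _ (hω.inter ha),
    ← hX.effect_mul hω ha, mul_apply_eq_comp]

/-- Domination of the laws transfers finiteness of second moments from x to T x, which makes the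
domain of A invariant under T. -/
lemma IsSharp.law_map_le (hX : X.IsSharp) {T : H →L[ℂ] H}
    (hT : ∀ ω, MeasurableSet ω → Commute (X.effect ω) T) (x : H) :
    X.law (T x) ≤ ‖T‖ₑ ^ 2 • X.law x := by
  refine Measure.le_iff.2 fun ω hω => ?_
  rw [Measure.smul_apply, smul_eq_mul, hX.law_apply _ hω, hX.law_apply _ hω, ← mul_pow,
    ← mul_apply_eq_comp, (hT ω hω).eq, mul_apply_eq_comp]
  gcongr
  exact T.le_opENorm _

lemma re_inner_polarization {P : H →L[ℂ] H} (hP : IsSelfAdjoint P) (y z : H) :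
    (⟪y + z, P (y + z)⟫_ℂ).re - (⟪y - z, P (y - z)⟫_ℂ).re = 4 * (⟪y, P z⟫_ℂ).re := by
  have h : (⟪z, P y⟫_ℂ).re = (⟪y, P z⟫_ℂ).re := by
    rw [← inner_star_left, hP.star_eq, ← inner_conj_symm, Complex.conj_re]
  simp only [map_add, map_sub, inner_add_left, inner_sub_left, inner_add_right, inner_sub_right,
    Complex.add_re, Complex.sub_re, h]
  ring

lemma IsSharp.commute_star (hX : X.IsSharp) {T : H →L[ℂ] H}
    (hT : ∀ ω, MeasurableSet ω → Commute (X.effect ω) T) (ω : Set Ω) (hω : MeasurableSet ω) :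
    Commute (X.effect ω) (star T) := by
  have := (hT ω hω).star_star
  rwa [(hX ω hω).isSelfAdjoint.star_eq] at this

/-- Both sides of ⟨y, X(ω) T x⟩ = ⟨T† y, X(ω) x⟩ are polarized. The negative terms are moved across,
so that the identity is one between positive measures. -/
lemma IsSharp.law_polarization (hX : X.IsSharp) {T : H →L[ℂ] H}
    (hT : ∀ ω, MeasurableSet ω → Commute (X.effect ω) T) (x y : H) :
    X.law (y + T x) + X.law (star T y - x) = X.law (y - T x) + X.law (star T y + x) := by
  ext ω hω
  have hsa := (hX ω hω).isSelfAdjoint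
  have h1 := re_inner_polarization hsa y (T x)
  have h2 := re_inner_polarization hsa (star T y) x
  have h3 : ⟪y, X.effect ω (T x)⟫_ℂ = ⟪star T y, X.effect ω x⟫_ℂ := by
    rw [inner_star_left, ← mul_apply_eq_comp, (hT ω hω).eq, mul_apply_eq_comp]
  rw [h3] at h1
  have nn := fun z => X.re_inner_effect_nonneg z hω
  simp only [Measure.add_apply, Observable.law_apply _ _ hω]
  rw [← ENNReal.ofReal_add (nn _) (nn _), ← ENNReal.ofReal_add (nn _) (nn _)]
  congr 1
  linarith

/-- Operators commuting with the effects of a generating `π`-system commute with all effects. -/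
lemma commute_effect_of_isPiSystem (X : Observable Ω H) {s : Set (Set Ω)}
    (hs : ‹MeasurableSpace Ω› = MeasurableSpace.generateFrom s) (hpi : IsPiSystem s)
    {T : H →L[ℂ] H} (hT : ∀ ω ∈ s, Commute (X.effect ω) T) (ω : Set Ω) (hω : MeasurableSet ω) :
    Commute (X.effect ω) T := by
  induction ω, hω using MeasurableSpace.induction_on_inter hs hpi with
  | empty => rw [X.effect_empty']; exact Commute.zero_left _
  | basic t ht => exact hT t ht
  | compl t htm ih => rw [X.effect_compl htm]; exact (Commute.one_left _).sub_left ih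
  | iUnion f hd hf ih =>
    refine eq_of_inner_self_eq_of_norm_eq_one fun x _ => ?_
    have h1 := X.hasSum_iUnion f hf hd x (T x)
    have h2 := X.hasSum_iUnion f hf hd (star T x) x
    simp only [inner_star_left, ← mul_apply_eq_comp, (ih _).eq] at h1 h2
    exact h1.unique h2

end Observable

/-! ### Self-adjoint and symmetric operators. -/

section SelfAdjoint

variable {H : Type*} [NormedAddCommGroup H] [InnerProductSpace ℂ H] [CompleteSpace H]
  {A : H →ₗ.[ℂ] H}

lemma inner_apply_eq_of_isSelfAdjoint (hA : IsSelfAdjoint A) (x y : A.domain) :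
    ⟪A x, (y : H)⟫_ℂ = ⟪(x : H), A y⟫_ℂ := by
  have h := LinearPMap.adjoint_isFormalAdjoint hA.dense_domain
  rw [LinearPMap.isSelfAdjoint_def.1 hA] at h
  exact h x y

omit [CompleteSpace H] in
lemma CommutesWith.mul {T S : H →L[ℂ] H} (hT : CommutesWith A T) (hS : CommutesWith A S) :
    CommutesWith A (T * S) := by
  intro x
  obtain ⟨h1, e1⟩ := hS x
  obtain ⟨h2, e2⟩ := hT ⟨S x, h1⟩
  exact ⟨h2, e2.trans (congrArg T e1)⟩

/-- The identity ⟨T† A x, y⟩ = ⟨T† x, A y⟩ puts T† x in the domain of A† = A. -/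
lemma CommutesWith.star (hA : IsSelfAdjoint A) {T : H →L[ℂ] H} (hT : CommutesWith A T) :
    CommutesWith A (Star.star T) := by
  intro x
  have key : ∀ y : A.domain, ⟪Star.star T (A x), (y : H)⟫_ℂ = ⟪Star.star T (x : H), A y⟫_ℂ := by
    intro y
    obtain ⟨h, e⟩ := hT y
    rw [inner_star_left, inner_star_left, ← e, ← inner_apply_eq_of_isSelfAdjoint hA]
  have hmem : Star.star T (x : H) ∈ A.domain := by
    have h := LinearPMap.mem_adjoint_domain_of_exists (T := A) (Star.star T (x : H)) ⟨_, key⟩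
    rwa [LinearPMap.isSelfAdjoint_def.1 hA] at h
  refine ⟨hmem, hA.dense_domain.eq_of_inner_left ℂ fun v hv => ?_⟩
  rw [inner_apply_eq_of_isSelfAdjoint hA _ ⟨v, hv⟩, key ⟨v, hv⟩]

omit [CompleteSpace H] in
/-- A symmetric operator is bounded by the bounds of its quadratic form. -/
lemma norm_apply_le_of_isSymmetric {S : H →ₗ[ℂ] H} (hS : S.IsSymmetric) {r : ℝ}
    (h : ∀ z, |(⟪z, S z⟫_ℂ).re| ≤ r * ‖z‖ ^ 2) (x : H) : ‖S x‖ ≤ r * ‖x‖ := by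
  rcases eq_or_ne (S x) 0 with h0 | h0
  · have h1 := (abs_nonneg _).trans (h x)
    rw [h0, norm_zero]
    rcases eq_or_ne x 0 with rfl | hx
    · simp
    · have : 0 < ‖x‖ := norm_pos_iff.2 hx
      have : 0 ≤ r := nonneg_of_mul_nonneg_left h1 (by positivity)
      positivity
  have hx : x ≠ 0 := by rintro rfl; simp at h0
  have px : 0 < ‖x‖ := norm_pos_iff.2 hx
  have pu : 0 < ‖S x‖ := norm_pos_iff.2 h0
  -- S x and x are rescaled to equal norms, so that polarization and the parallelogram law give the
  -- bound r without loss.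
  set p : H := (‖x‖ : ℂ) • S x
  set q : H := (‖S x‖ : ℂ) • x
  have hqp : (⟪q, S p⟫_ℂ).re = (⟪p, S q⟫_ℂ).re := by
    rw [← hS, ← inner_conj_symm, Complex.conj_re]
  have hpq : (⟪p, S q⟫_ℂ).re = ‖x‖ * ‖S x‖ * ‖S x‖ ^ 2 := by
    simp only [p, q, map_smul, inner_smul_left, inner_smul_right, Complex.conj_ofReal]
    have hu : (⟪S x, S x⟫_ℂ).re = ‖S x‖ ^ 2 := inner_self_eq_norm_sq (𝕜 := ℂ) (S x)
    rw [Complex.re_ofReal_mul, Complex.re_ofReal_mul, hu]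
    ring
  have np : ‖p‖ = ‖x‖ * ‖S x‖ := by simp [p, norm_smul]
  have nq : ‖q‖ = ‖x‖ * ‖S x‖ := by simp [q, norm_smul, mul_comm]
  have hpol : (⟪p + q, S (p + q)⟫_ℂ).re - (⟪p - q, S (p - q)⟫_ℂ).re = 4 * (⟪p, S q⟫_ℂ).re := by
    simp only [map_add, map_sub, inner_add_left, inner_sub_left, inner_add_right, inner_sub_right,
      Complex.add_re, Complex.sub_re, hqp]
    ring
  have b1 := (abs_le.1 (h (p + q))).2
  have b2 := (abs_le.1 (h (p - q))).1
  have par := parallelogram_law_with_norm ℂ p q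
  rw [np, nq] at par
  have fin : 4 * (‖x‖ * ‖S x‖ * ‖S x‖ ^ 2) ≤ r * (4 * (‖x‖ * ‖S x‖) ^ 2) := by
    have : r * (4 * (‖x‖ * ‖S x‖) ^ 2) = r * ‖p + q‖ ^ 2 + r * ‖p - q‖ ^ 2 := by
      rw [← mul_add]; congr 1; linarith
    rw [this, ← hpq]
    linarith
  have pos : 0 < 4 * (‖x‖ * ‖S x‖ ^ 2) := by positivity
  refine le_of_mul_le_mul_left ?_ pos
  linarith

end SelfAdjoint

/-! ### Commuting with A versus commuting with its spectral projectors. -/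

namespace Observable.IsRepresentedBy

variable {H : Type*} [NormedAddCommGroup H] [InnerProductSpace ℂ H] [CompleteSpace H]
  {A : H →ₗ.[ℂ] H} {X : Observable ℝ H}

lemma re_inner (hX : X.IsRepresentedBy A) (x : A.domain) :
    (⟪(x : H), A x⟫_ℂ).re = ∫ t : ℝ, t ∂(X.law x) := by
  rw [hX.inner_apply, Complex.ofReal_re]

lemma integrable_id (hX : X.IsRepresentedBy A) (x : A.domain) :
    Integrable (fun t : ℝ => t) (X.law x) := by
  have h := (hX.mem_domain_iff x).1 x.2
  refine ((integrable_const (1 : ℝ)).add h).mono' measurable_id.aestronglyMeasurable ?_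
  refine ae_of_all _ fun t => ?_
  simp only [Pi.add_apply, Real.norm_eq_abs]
  nlinarith [sq_abs t, sq_nonneg (|t| - 1), abs_nonneg t]

lemma map_mem_domain (hX : X.IsRepresentedBy A) {T : H →L[ℂ] H}
    (hT : ∀ ω, MeasurableSet ω → Commute (X.effect ω) T) (x : A.domain) : T x ∈ A.domain := by
  rw [hX.mem_domain_iff]
  exact (((hX.mem_domain_iff x).1 x.2).smul_measure (by finiteness)).mono_measure
    (hX.isSharp.law_map_le hT x)

lemma re_inner_polarization (hA : IsSelfAdjoint A) (y z : A.domain) :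
    (⟪((y + z : A.domain) : H), A (y + z)⟫_ℂ).re - (⟪((y - z : A.domain) : H), A (y - z)⟫_ℂ).re =
      4 * (⟪(y : H), A z⟫_ℂ).re := by
  have h : (⟪(z : H), A y⟫_ℂ).re = (⟪(y : H), A z⟫_ℂ).re := by
    rw [← inner_apply_eq_of_isSelfAdjoint hA, ← inner_conj_symm, Complex.conj_re]
  simp only [LinearPMap.map_add, LinearPMap.map_sub, Submodule.coe_add, Submodule.coe_sub,
    inner_add_left, inner_sub_left, inner_add_right, inner_sub_right, Complex.add_re,
    Complex.sub_re, h]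
  ring

/-- An operator commuting with the spectral projectors of `A` commutes with `A`. -/
lemma commutesWith (hX : X.IsRepresentedBy A) {T : H →L[ℂ] H}
    (hT : ∀ ω, MeasurableSet ω → Commute (X.effect ω) T) : CommutesWith A T := by
  intro x
  have hTx := hX.map_mem_domain hT x
  refine ⟨hTx, ?_⟩
  have hre : ∀ y : A.domain, (⟪(y : H), A ⟨T x, hTx⟩⟫_ℂ).re = (⟪(y : H), T (A x)⟫_ℂ).re := by
    intro y
    have hTy := hX.map_mem_domain (hX.isSharp.commute_star hT) y
    have h1 := re_inner_polarization hX.isSelfAdjoint y ⟨T x, hTx⟩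
    have h2 := re_inner_polarization hX.isSelfAdjoint ⟨star T y, hTy⟩ x
    have hm : ∫ t : ℝ, t ∂(X.law (y + ⟨T x, hTx⟩ : A.domain) +
          X.law (⟨star T y, hTy⟩ - x : A.domain)) =
        ∫ t : ℝ, t ∂(X.law (y - ⟨T x, hTx⟩ : A.domain) +
          X.law (⟨star T y, hTy⟩ + x : A.domain)) :=
      -- Integrating t against the polarized measure identity turns it into ⟨y, A T x⟩ = ⟨T† y, A
      -- x⟩, in real parts.
      congrArg (fun μ => ∫ t : ℝ, t ∂μ) (hX.isSharp.law_polarization hT x y)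
    rw [integral_add_measure (hX.integrable_id (y + ⟨T x, hTx⟩))
        (hX.integrable_id (⟨star T y, hTy⟩ - x)),
      integral_add_measure (hX.integrable_id (y - ⟨T x, hTx⟩))
        (hX.integrable_id (⟨star T y, hTy⟩ + x))] at hm
    rw [hX.re_inner, hX.re_inner] at h1 h2
    rw [← inner_star_left T]
    linarith
  refine hX.isSelfAdjoint.dense_domain.eq_of_inner_right ℂ fun v hv => ?_
  refine Complex.ext (hre ⟨v, hv⟩) ?_
  -- Replacing v by i v recovers the imaginary part.
  have h := hre (Complex.I • ⟨v, hv⟩)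
  simpa [inner_smul_left] using h

lemma commutesWith_effect (hX : X.IsRepresentedBy A) {ω : Set ℝ} (hω : MeasurableSet ω) :
    CommutesWith A (X.effect ω) :=
  hX.commutesWith fun _ h => hX.isSharp.commute_effect h hω

lemma effect_mem_domain (hX : X.IsRepresentedBy A) (a b : ℝ) (x : H) :
    X.effect (Set.Icc a b) x ∈ A.domain := by
  rw [hX.mem_domain_iff, hX.isSharp.law_effect x measurableSet_Icc]
  exact (continuous_pow 2).continuousOn.integrableOn_Icc

lemma law_eq_restrict (hX : X.IsRepresentedBy A) {ω : Set ℝ} (hω : MeasurableSet ω) {x : H}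
    (hx : X.effect ω x = x) : X.law x = (X.law x).restrict ω := by
  conv_lhs => rw [← hx, hX.isSharp.law_effect x hω]

lemma le_re_inner (hX : X.IsRepresentedBy A) {ω : Set ℝ} (hω : MeasurableSet ω) {b : ℝ}
    (hb : ∀ t ∈ ω, b ≤ t) (x : A.domain) (hx : X.effect ω x = x) :
    b * ‖(x : H)‖ ^ 2 ≤ (⟪(x : H), A x⟫_ℂ).re := by
  rw [hX.re_inner, ← X.law_real_univ, mul_comm, ← smul_eq_mul, ← integral_const]
  refine integral_mono_ae (integrable_const _) (hX.integrable_id x) ?_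
  rw [hX.law_eq_restrict hω hx]
  exact (ae_restrict_mem hω).mono hb

lemma re_inner_le (hX : X.IsRepresentedBy A) {ω : Set ℝ} (hω : MeasurableSet ω) {b : ℝ}
    (hb : ∀ t ∈ ω, t ≤ b) (x : A.domain) (hx : X.effect ω x = x) :
    (⟪(x : H), A x⟫_ℂ).re ≤ b * ‖(x : H)‖ ^ 2 := by
  rw [hX.re_inner, ← X.law_real_univ, mul_comm, ← smul_eq_mul, ← integral_const]
  refine integral_mono_ae (hX.integrable_id x) (integrable_const _) ?_
  rw [hX.law_eq_restrict hω hx]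
  exact (ae_restrict_mem hω).mono hb

lemma effect_effect (hX : X.IsRepresentedBy A) {ω : Set ℝ} (hω : MeasurableSet ω) (x : H) :
    X.effect ω (X.effect ω x) = X.effect ω x :=
  DFunLike.congr_fun (hX.isSharp ω hω).isIdempotentElem.eq x

omit [CompleteSpace H] in
lemma re_inner_sub_smul (x y : H) (c : ℝ) :
    (⟪x, y - (c : ℂ) • x⟫_ℂ).re = (⟪x, y⟫_ℂ).re - c * ‖x‖ ^ 2 := by
  rw [inner_sub_right, inner_smul_right, Complex.sub_re, Complex.re_ofReal_mul]
  congr 2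
  exact inner_self_eq_norm_sq (𝕜 := ℂ) x

/-- Cauchy–Schwarz applied to ⟨x, (A - c) x⟩ ≥ (b - c) ‖x‖². -/
lemma mul_norm_le_norm_sub (hX : X.IsRepresentedBy A) {b c : ℝ} (x : A.domain)
    (hx : X.effect (Set.Ici b) x = x) : (b - c) * ‖(x : H)‖ ≤ ‖A x - (c : ℂ) • (x : H)‖ := by
  have h := hX.le_re_inner measurableSet_Ici (fun t ht => ht) x hx
  have h2 := re_inner_sub_smul (x : H) (A x) c
  have h3 := (Complex.re_le_norm _).trans (norm_inner_le_norm (𝕜 := ℂ) (x : H)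
    (A x - (c : ℂ) • (x : H)))
  rcases eq_or_ne (x : H) 0 with h0 | h0
  · rw [h0, norm_zero, mul_zero]; positivity
  · refine le_of_mul_le_mul_left ?_ (norm_pos_iff.2 h0)
    nlinarith

/-- `(A - c) X([a, b])` as an everywhere defined operator. -/
noncomputable def truncation (hX : X.IsRepresentedBy A) (a b c : ℝ) : H →ₗ[ℂ] H :=
  A.toFun ∘ₗ ((X.effect (Set.Icc a b) : H →ₗ[ℂ] H).codRestrict A.domain
    (hX.effect_mem_domain a b)) - (c : ℂ) • (X.effect (Set.Icc a b) : H →ₗ[ℂ] H)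

lemma truncation_apply (hX : X.IsRepresentedBy A) (a b c : ℝ) (x : H) :
    hX.truncation a b c x = A ⟨X.effect (Set.Icc a b) x, hX.effect_mem_domain a b x⟩ -
      (c : ℂ) • X.effect (Set.Icc a b) x := rfl

omit [CompleteSpace H] in
lemma apply_eq_of_eq {x y : A.domain} (h : (x : H) = y) : A x = A y := by
  rw [Subtype.ext h]

lemma effect_truncation (hX : X.IsRepresentedBy A) (a b c : ℝ) (x : H) :
    X.effect (Set.Icc a b) (hX.truncation a b c x) = hX.truncation a b c x := by
  obtain ⟨h, e⟩ := hX.commutesWith_effect (measurableSet_Icc (a := a) (b := b))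
    ⟨X.effect (Set.Icc a b) x, hX.effect_mem_domain a b x⟩
  rw [truncation_apply, map_sub, map_smul, ← e]
  exact congrArg₂ (fun u v => u - (c : ℂ) • v)
    (apply_eq_of_eq (hX.effect_effect measurableSet_Icc x))
    (hX.effect_effect measurableSet_Icc x)

lemma inner_truncation (hX : X.IsRepresentedBy A) (a b c : ℝ) (x y : H) :
    ⟪x, hX.truncation a b c y⟫_ℂ = ⟪X.effect (Set.Icc a b) x, hX.truncation a b c y⟫_ℂ := by
  conv_lhs => rw [← hX.effect_truncation, ← inner_star_left,
    (hX.isSharp _ measurableSet_Icc).isSelfAdjoint.star_eq]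

lemma isSymmetric_truncation (hX : X.IsRepresentedBy A) (a b c : ℝ) :
    (hX.truncation a b c).IsSymmetric := by
  intro x y
  rw [hX.inner_truncation, ← inner_conj_symm, hX.inner_truncation, inner_conj_symm,
    truncation_apply, truncation_apply, inner_sub_left, inner_sub_right, inner_smul_left,
    inner_smul_right, Complex.conj_ofReal]
  congr 1
  exact inner_apply_eq_of_isSelfAdjoint hX.isSelfAdjoint ⟨_, hX.effect_mem_domain a b x⟩
    ⟨_, hX.effect_mem_domain a b y⟩

/-- Centring at the midpoint places the quadratic form between ±(b - a)/2, and a symmetric operator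
is bounded by its form. -/
lemma norm_truncation_le (hX : X.IsRepresentedBy A) {a b : ℝ} (hab : a ≤ b) (x : H) :
    ‖hX.truncation a b ((a + b) / 2) x‖ ≤ (b - a) / 2 * ‖x‖ := by
  refine norm_apply_le_of_isSymmetric (hX.isSymmetric_truncation a b _) (fun z => ?_) x
  have hz := hX.effect_effect (measurableSet_Icc (a := a) (b := b)) z
  have h1 := hX.le_re_inner measurableSet_Icc (fun t ht => ht.1)
    ⟨_, hX.effect_mem_domain a b z⟩ hz
  have h2 := hX.re_inner_le measurableSet_Icc (fun t ht => ht.2)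
    ⟨_, hX.effect_mem_domain a b z⟩ hz
  have hn : ‖X.effect (Set.Icc a b) z‖ ≤ ‖z‖ :=
    ((X.effect (Set.Icc a b)).le_opNorm z).trans
      (mul_le_of_le_one_left (norm_nonneg _) (hX.isSharp _ measurableSet_Icc).norm_le)
  rw [hX.inner_truncation, truncation_apply, re_inner_sub_smul]
  dsimp only at h1 h2
  have h3 : (b - a) / 2 * ‖X.effect (Set.Icc a b) z‖ ^ 2 ≤ (b - a) / 2 * ‖z‖ ^ 2 := by
    have : 0 ≤ (b - a) / 2 := by linarith
    gcongr
  refine le_trans ?_ h3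
  rw [abs_le]
  constructor <;> nlinarith

/-- Operators commuting with `A` do not raise the spectral value. -/
lemma effect_Ici_mul_mul_effect_Icc (hX : X.IsRepresentedBy A) {T : H →L[ℂ] H}
    (hT : CommutesWith A T) {a b b' : ℝ} (hb : b < b') :
    X.effect (Set.Ici b') * T * X.effect (Set.Icc a b) = 0 := by
  rcases lt_or_ge b a with hab | hab
  · rw [Set.Icc_eq_empty hab.not_ge, X.effect_empty', mul_zero]
  set S := X.effect (Set.Ici b') * T * X.effect (Set.Icc a b) with hS
  set c := (a + b) / 2 with hc
  -- S intertwines A - c on the two spectral subspaces: it is at least b' - c on the target and at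
  -- most (b - a)/2 = b - c on the source. As b' > b, this forces S = 0.
  have key : ∀ x, (b' - c) * ‖S x‖ ≤ ‖S‖ * ((b - a) / 2) * ‖x‖ := by
    intro x
    obtain ⟨h, e⟩ := ((hX.commutesWith_effect (measurableSet_Ici (a := b'))).mul hT)
      ⟨_, hX.effect_mem_domain a b x⟩
    have h1 : A ⟨S x, h⟩ - (c : ℂ) • S x = S (hX.truncation a b c x) := by
      have e2 : A ⟨S x, h⟩ = (X.effect (Set.Ici b') * T)
          (A ⟨_, hX.effect_mem_domain a b x⟩) := e
      rw [e2, hS, mul_apply_eq_comp _ _ (hX.truncation a b c x), hX.effect_truncation,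
        truncation_apply, map_sub, map_smul]
      rfl
    have h2 := hX.mul_norm_le_norm_sub (b := b') (c := c) ⟨S x, h⟩
      (hX.effect_effect measurableSet_Ici _)
    rw [h1] at h2
    calc _ ≤ _ := h2
      _ ≤ ‖S‖ * ‖hX.truncation a b c x‖ := S.le_opNorm _
      _ ≤ ‖S‖ * ((b - a) / 2 * ‖x‖) := by gcongr; exact hX.norm_truncation_le hab x
      _ = _ := by ring
  have hpos : 0 < b' - c := by rw [hc]; linarith
  have h3 : ‖S‖ ≤ ‖S‖ * ((b - a) / 2) / (b' - c) := by
    refine S.opNorm_le_bound ?_ fun x => ?_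
    · have : 0 ≤ b - a := by linarith
      positivity
    · rw [div_mul_eq_mul_div, le_div_iff₀ hpos, mul_comm]
      exact key x
  rw [le_div_iff₀ hpos] at h3
  have h4 : ‖S‖ * (b' - b) ≤ 0 := by rw [hc] at h3; linarith
  exact norm_le_zero_iff.1 (nonpos_of_mul_nonpos_left h4 (by linarith))

/-- The gap b' - b is closed by writing (b, ∞) as a countable union of rays [b', ∞); a countable
union of null sets of the law is null. -/
lemma effect_Ioi_mul_mul_effect_Icc (hX : X.IsRepresentedBy A) {T : H →L[ℂ] H}
    (hT : CommutesWith A T) (a b : ℝ) :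
    X.effect (Set.Ioi b) * T * X.effect (Set.Icc a b) = 0 := by
  ext x
  rw [mul_apply_eq_comp, mul_apply_eq_comp, zero_apply,
    ← hX.isSharp.law_eq_zero_iff _ measurableSet_Ioi]
  have hU : Set.Ioi b = ⋃ n : ℕ, Set.Ici (b + 1 / ((n : ℝ) + 1)) := by
    ext t
    simp only [Set.mem_Ioi, Set.mem_iUnion, Set.mem_Ici]
    constructor
    · intro h
      obtain ⟨n, hn⟩ := exists_nat_one_div_lt (sub_pos.2 h)
      exact ⟨n, by linarith⟩
    · rintro ⟨n, hn⟩
      have : 0 < 1 / ((n : ℝ) + 1) := by positivity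
      linarith
  rw [hU, measure_iUnion_null_iff]
  intro n
  rw [hX.isSharp.law_eq_zero_iff _ measurableSet_Ici]
  have : 0 < 1 / ((n : ℝ) + 1) := by positivity
  exact DFunLike.congr_fun (hX.effect_Ici_mul_mul_effect_Icc hT
    (a := a) (b := b) (b' := b + 1 / ((n : ℝ) + 1)) (by linarith)) x

/-- Taking adjoints of the previous relation for T† moves the bounded interval to the left, where it
can be exhausted to (-∞, b] by countable additivity. -/
lemma effect_Iic_mul_mul_effect_Ioi (hX : X.IsRepresentedBy A) {T : H →L[ℂ] H}
    (hT : CommutesWith A T) (b : ℝ) : X.effect (Set.Iic b) * T * X.effect (Set.Ioi b) = 0 := by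
  ext x
  rw [mul_apply_eq_comp, mul_apply_eq_comp, zero_apply,
    ← hX.isSharp.law_eq_zero_iff _ measurableSet_Iic]
  have hU : Set.Iic b = ⋃ n : ℕ, Set.Icc (-(n : ℝ)) b := by
    ext t
    simp only [Set.mem_Iic, Set.mem_iUnion, Set.mem_Icc]
    constructor
    · intro h
      obtain ⟨n, hn⟩ := exists_nat_ge (-t)
      exact ⟨n, by linarith, h⟩
    · rintro ⟨n, -, hn⟩
      exact hn
  rw [hU, measure_iUnion_null_iff]
  intro n
  rw [hX.isSharp.law_eq_zero_iff _ measurableSet_Icc]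
  have h := congrArg Star.star
    (hX.effect_Ioi_mul_mul_effect_Icc (hT.star hX.isSelfAdjoint) (-(n : ℝ)) b)
  rw [star_mul, star_mul, star_star, star_zero,
    (hX.isSharp _ measurableSet_Icc).isSelfAdjoint.star_eq,
    (hX.isSharp _ measurableSet_Ioi).isSelfAdjoint.star_eq] at h
  exact DFunLike.congr_fun h x

/-- An operator commutes with `A` if and only if it commutes with its spectral projectors. -/
theorem commutesWith_iff (hX : X.IsRepresentedBy A) {T : H →L[ℂ] H} :
    CommutesWith A T ↔ ∀ ω, MeasurableSet ω → Commute (X.effect ω) T := by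
  refine ⟨fun hT => ?_, hX.commutesWith⟩
  refine X.commute_effect_of_isPiSystem
    ((BorelSpace.measurable_eq (α := ℝ)).trans (borel_eq_generateFrom_Iic ℝ)) isPiSystem_Iic ?_
  rintro _ ⟨b, rfl⟩
  have h1 := hX.effect_Iic_mul_mul_effect_Ioi hT b
  -- The adjoint of this relation is the other off-diagonal block of T.
  have h2 := hX.effect_Iic_mul_mul_effect_Ioi (hT.star hX.isSelfAdjoint) b
  have h3 := congrArg Star.star h2
  have hI := (hX.isSharp _ (measurableSet_Iic (a := b))).isSelfAdjoint.star_eq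
  rw [star_mul, star_mul, star_star, star_zero, hI,
    (hX.isSharp _ measurableSet_Ioi).isSelfAdjoint.star_eq] at h3
  have hc : X.effect (Set.Ioi b) = 1 - X.effect (Set.Iic b) := by
    rw [← X.effect_compl measurableSet_Iic, Set.compl_Iic]
  rw [hc, mul_sub, mul_one, sub_eq_zero] at h1
  rw [hc, ← mul_assoc, sub_mul, sub_mul, one_mul, sub_eq_zero] at h3
  exact h1.trans h3.symm

end Observable.IsRepresentedBy

/-! ### The noiseless algebra and affiliation. -/

section Noiseless

variable {H : Type*} [NormedAddCommGroup H] [InnerProductSpace ℂ H] [CompleteSpace H]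
  {ι : Type*} {E : ι → H →L[ℂ] H}

lemma mem_noiselessAlgebra {B : H →L[ℂ] H} :
    B ∈ noiselessAlgebra E ↔ ∀ k, B * E k = E k * B ∧ star B * E k = E k * star B :=
  Iff.rfl

lemma mem_commutant_noiselessAlgebra (k : ι) : E k ∈ (noiselessAlgebra E).commutant :=
  VonNeumannAlgebra.mem_commutant_iff.2 fun _ hg => (mem_noiselessAlgebra.1 hg k).1

omit [CompleteSpace H] in
lemma commutesWith_toPMap_top_iff {A T : H →L[ℂ] H} :
    CommutesWith ((A : H →ₗ[ℂ] H).toPMap ⊤) T ↔ A * T = T * A := by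
  constructor
  · intro h
    ext x
    obtain ⟨_, e⟩ := h ⟨x, Submodule.mem_top⟩
    exact e
  · intro h x
    exact ⟨Submodule.mem_top, DFunLike.congr_fun h (x : H)⟩

lemma isSelfAdjoint_of_toPMap_top {A : H →L[ℂ] H}
    (hA : IsSelfAdjoint ((A : H →ₗ[ℂ] H).toPMap ⊤)) : IsSelfAdjoint A := by
  rw [ContinuousLinearMap.isSelfAdjoint_iff_isSymmetric]
  intro x y
  exact inner_apply_eq_of_isSelfAdjoint hA ⟨x, Submodule.mem_top⟩ ⟨y, Submodule.mem_top⟩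

lemma QuantumChannel.HasElements.isFixedBy_iff_commutesWith {𝓔 : QuantumChannel H}
    (hE : 𝓔.HasElements E) {X : Observable ℝ H} {A : H →ₗ.[ℂ] H} (hX : X.IsRepresentedBy A) :
    X.IsFixedBy 𝓔 ↔ ∀ k, CommutesWith A (E k) := by
  simp only [hE.isFixedBy_iff hX.isSharp, hX.commutesWith_iff]

/-- The effects of a fixed X are self-adjoint and commute with each E_k, so they lie in the
noiseless algebra and its commutant commutes with them. Conversely, affiliation is tested on the E_k
alone. -/
lemma QuantumChannel.HasElements.isFixedBy_iff_isAffiliatedWith {𝓔 : QuantumChannel H}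
    (hE : 𝓔.HasElements E) {X : Observable ℝ H} {A : H →ₗ.[ℂ] H} (hX : X.IsRepresentedBy A) :
    X.IsFixedBy 𝓔 ↔ IsAffiliatedWith A (noiselessAlgebra E) := by
  constructor
  · intro h B hB
    refine hX.commutesWith fun ω hω => VonNeumannAlgebra.mem_commutant_iff.1 hB _ ?_
    refine mem_noiselessAlgebra.2 fun k => ?_
    rw [(hX.isSharp ω hω).isSelfAdjoint.star_eq, and_self]
    exact (hE.isFixedBy_iff hX.isSharp).1 h k ω hω
  · exact fun h => (hE.isFixedBy_iff_commutesWith hX).2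
      fun k => h _ (mem_commutant_noiselessAlgebra k)

end Noiseless

end QInfo

theorem mainTheorem8 {H : Type*} [NormedAddCommGroup H] [InnerProductSpace ℂ H] [CompleteSpace H]
    {ι : Type*} (𝓔 : QInfo.QuantumChannel H) (E : ι → H →L[ℂ] H) (hE : 𝓔.HasElements E)
    (X : QInfo.Observable ℝ H) :
    -- bounded self-adjoint operators
    (∀ A : H →L[ℂ] H, X.IsRepresentedBy ((A : H →ₗ[ℂ] H).toPMap ⊤) →
      (X.IsFixedBy 𝓔 ↔ A ∈ QInfo.noiselessAlgebra E) ∧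
      (X.IsFixedBy 𝓔 ↔ ∀ k, A * E k = E k * A)) ∧
    -- possibly unbounded self-adjoint operators
    (∀ A : H →ₗ.[ℂ] H, X.IsRepresentedBy A →
      (X.IsFixedBy 𝓔 ↔ QInfo.IsAffiliatedWith A (QInfo.noiselessAlgebra E)) ∧
      (X.IsFixedBy 𝓔 ↔ ∀ k, QInfo.CommutesWith A (E k))) := by
  refine ⟨fun A hX => ?_, fun A hX =>
    ⟨hE.isFixedBy_iff_isAffiliatedWith hX, hE.isFixedBy_iff_commutesWith hX⟩⟩
  have h := hE.isFixedBy_iff_commutesWith hX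
  simp only [QInfo.commutesWith_toPMap_top_iff] at h
  refine ⟨h.trans ?_, h⟩
  simp only [QInfo.mem_noiselessAlgebra,
    (QInfo.isSelfAdjoint_of_toPMap_top hX.isSelfAdjoint).star_eq, and_self]
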